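/- Let $\mathcal Y\subset(0,\infty)$ be a countable set that is bounded above, write $\max\mathcal Y$ for its supremum, and let $Y=(Y(t))_{t\ge 0}$ be a continuous-time Markov chain with values in $\mathcal Y$, arbitrary initial law, càdlàg (piecewise constant) paths, and conservative intensity matrix $Q$. Assume that $Y$ is irreducible and positive recurrent, with invariant probability measure $\pi$. Let $c\in\mathbb R$, let $(\nu_y)_{y\in\mathcal Y}$ be probability measures on $(-\infty,c)$, and let $\xi_0<c$ be deterministic. For $\varepsilon>0$ put $Y_\varepsilon(t)=Y(t/\varepsilon)$, and let $X_\varepsilon$ be the following process. Set $T^*_0=0$. For $k\ge 0$, given $T^*_k<\infty$ and the position $\xi_k<c$ (with $\xi_0$ as above), let $$T^*_{k+1}=\inf\Big\{t>T^*_k:\ \xi_k+\int_{T^*_k}^tY_\varepsilon(s)\,ds=c\Big\},\qquad X_\varepsilon(t)=\xi_k+\int_{T^*_k}^tY_\varepsilon(s)\,ds\quad\text{for } T^*_k\le t<T^*_{k+1},$$ and, if $T^*_{k+1}<\infty$, draw the new position $\xi_{k+1}=X_\varepsilon(T^*_{k+1})$, conditionally on $Y$ and $\xi_0,\dots,\xi_k$,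 from the law $\nu_{Y_\varepsilon(T^{*}_{k+1}-)}$. (The times and positions depend on $\varepsilon$.) Let $\eta>0$ and $T=\frac{c-\xi_0}{\max\mathcal Y}-\eta$. Then for every $\varepsilon>0$ the first hitting time $T^*_1$ of the boundary $c$ is larger than $T$, so $X_\varepsilon$ does not reach the boundary on $[0,T]$. Moreover, as $\varepsilon\to0$, $X_\varepsilon$ converges in law, in the Skorokhod space $\mathbb D([0,T],\mathbb R)$ of càdlàg functions with the $J_1$ topology, to the deterministic linear path $$\bar X(t)=\xi_0+\int_0^t\int_{\mathcal Y}y\,\pi(dy)\,ds=\xi_0+\Big(\sum_{y\in\mathcal Y}y\,\pi(\{y\})\Big)t .$$ -/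

import Mathlib

open Set Filter Topology MeasureTheory ProbabilityTheory
open scoped ENNReal

namespace PLMP

/-! ### The Skorokhod space of càdlàg paths on a compact interval -/

/-- A real function on `[0,T]` is càdlàg: it is right-continuous and has left limits
(at the left endpoint the filter `𝓝[<] t` is trivial, so nothing is asked there). -/
def IsCadlag {T : ℝ} (x : Icc (0 : ℝ) T → ℝ) : Prop :=
  ∀ t, ContinuousWithinAt x (Ici t) t ∧ ∃ l, Tendsto x (𝓝[<] t) (𝓝 l)

/-- The space `D([0,T], ℝ)` of càdlàg functions. -/
structure Skorokhod (T : ℝ) where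
  path : Icc (0 : ℝ) T → ℝ
  isCadlag : IsCadlag path

namespace Skorokhod

variable {T : ℝ}

/-- The Skorokhod distance: the infimum, over the increasing bijections `r` of `[0,T]`, of
`max (sup_t |r t - t|) (sup_t |x t - y (r t)|)`. -/
noncomputable def dist (x y : Skorokhod T) : ℝ≥0∞ :=
  ⨅ r : Icc (0 : ℝ) T ≃o Icc (0 : ℝ) T,
    max (⨆ t, edist (r t) t) (⨆ t, edist (x.path t) (y.path (r t)))

theorem dist_self (x : Skorokhod T) : dist x x = 0 := by
  refine le_antisymm ?_ bot_le
  refine (iInf_le _ (OrderIso.refl _)).trans ?_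
  simp

theorem dist_comm_le (x y : Skorokhod T) : dist x y ≤ dist y x := by
  refine le_iInf fun r => (iInf_le _ r.symm).trans ?_
  refine max_le_max (iSup_le fun t => ?_) (iSup_le fun t => ?_)
  · refine le_trans (le_of_eq ?_) (le_iSup _ (r.symm t))
    rw [edist_comm, OrderIso.apply_symm_apply]
  · refine le_trans (le_of_eq ?_) (le_iSup _ (r.symm t))
    rw [edist_comm, OrderIso.apply_symm_apply]

theorem dist_triangle (x y z : Skorokhod T) : dist x z ≤ dist x y + dist y z := by
  unfold dist
  refine ENNReal.le_iInf_add_iInf fun r r' => ?_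
  refine (iInf_le _ (r.trans r')).trans (max_le (iSup_le fun t => ?_) (iSup_le fun t => ?_))
  · calc edist (r' (r t)) t ≤ edist (r t) t + edist (r' (r t)) (r t) := by
          rw [add_comm]; exact edist_triangle _ _ _
      _ ≤ _ := add_le_add
          ((le_iSup (fun t => edist (r t) t) t).trans (le_max_left _ _))
          ((le_iSup (fun t => edist (r' t) t) (r t)).trans (le_max_left _ _))
  · calc edist (x.path t) (z.path (r' (r t)))
        ≤ edist (x.path t) (y.path (r t)) + edist (y.path (r t)) (z.path (r' (r t))) := edist_triangle _ _ _
      _ ≤ _ := add_le_add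
          ((le_iSup (fun t => edist (x.path t) (y.path (r t))) t).trans (le_max_right _ _))
          ((le_iSup (fun t => edist (y.path t) (z.path (r' t))) (r t)).trans (le_max_right _ _))

/-- The Skorokhod (J1) topology, as the topology of the Skorokhod distance. -/
noncomputable instance : PseudoEMetricSpace (Skorokhod T) where
  edist := dist
  edist_self := dist_self
  edist_comm x y := le_antisymm (dist_comm_le x y) (dist_comm_le y x)
  edist_triangle := dist_triangle

noncomputable instance : MeasurableSpace (Skorokhod T) := borel _

instance : BorelSpace (Skorokhod T) := ⟨rfl⟩

end Skorokhod

/-! ### Continuous-time Markov chains on a countable set of velocities -/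

/-- `P` is an honest standard transition function on the countable set `S`, with (stable and
conservative) intensity matrix `Q`, the derivative of `P` at time `0`. -/
structure IsTransitionFunction {S : Set ℝ} (P : ℝ → S → S → ℝ) (Q : S → S → ℝ) : Prop where
  nonneg : ∀ t, 0 ≤ t → ∀ x y, 0 ≤ P t x y
  hasSum_one : ∀ t, 0 ≤ t → ∀ x, HasSum (fun y => P t x y) 1
  zero_same : ∀ x, P 0 x x = 1
  zero_ne : ∀ x y, x ≠ y → P 0 x y = 0
  chapman_kolmogorov : ∀ s t, 0 ≤ s → 0 ≤ t → ∀ x z,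
    HasSum (fun y => P s x y * P t y z) (P (s + t) x z)
  hasDeriv_zero : ∀ x y, HasDerivWithinAt (fun t => P t x y) (Q x y) (Ici 0) 0
  conservative : ∀ x, HasSum (fun y => Q x y) 0

/-- Any state can be reached from any other one. -/
def IsIrreducible {S : Set ℝ} (P : ℝ → S → S → ℝ) : Prop :=
  ∀ x y, ∃ t, 0 ≤ t ∧ 0 < P t x y

/-- The measure `p` is invariant: `p P_t = p` for all `t ≥ 0`. An irreducible chain is positive
recurrent exactly when it has an invariant probability measure. -/
def IsInvariant {S : Set ℝ} (P : ℝ → S → S → ℝ) (p : Measure S) : Prop :=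
  ∀ t, 0 ≤ t → ∀ y, HasSum (fun x => p.real {x} * P t x y) (p.real {y})

/-- `Y = (Y_t)_{t ≥ 0}` is a continuous-time Markov chain with transition function `P`, with
arbitrary initial law. The paths are càdlàg for the discrete topology of `S`, i.e. they are
step functions with finitely many jumps on bounded intervals. Only times `t ≥ 0` matter. -/
structure IsMarkovChain {Ω : Type*} [MeasurableSpace Ω] (μ : Measure Ω) {S : Set ℝ}
    (P : ℝ → S → S → ℝ) (Y : ℝ → Ω → S) : Prop where
  measurable : ∀ t, 0 ≤ t → Measurable (Y t)
  right_cont : ∀ ω t, 0 ≤ t → ∀ᶠ s in 𝓝[>] t, Y s ω = Y t ω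
  left_lim : ∀ ω t, 0 < t → ∃ y, ∀ᶠ s in 𝓝[<] t, Y s ω = y
  /-- the Markov property with respect to the natural filtration -/
  markov : ∀ s t, 0 ≤ s → 0 ≤ t → ∀ A : Set Ω,
    MeasurableSet[⨆ u ∈ Icc (0 : ℝ) s, MeasurableSpace.comap (Y u) inferInstance] A →
    ∀ x y, μ.real (A ∩ {ω | Y s ω = x} ∩ {ω | Y (s + t) ω = y}) =
      μ.real (A ∩ {ω | Y s ω = x}) * P t x y

/-- The accelerated chain `Y_ε(t) = Y(t/ε)`. -/
noncomputable def accelerate {Ω : Type*} {S : Set ℝ} (Y : ℝ → Ω → S) (ε : ℝ) : ℝ → Ω → S :=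
  fun t => Y (t / ε)

/-! ### The piecewise linear process constrained to stay below the boundary `c` -/

/-- The first time `t > s` at which the path that is at `a` at time `s` and has velocity `v` hits
`c`; it is `⊤` if there is no such time, in particular if `s = ⊤`. -/
noncomputable def hitTime (c : ℝ) (v : ℝ → ℝ) (a : ℝ) (s : ℝ≥0∞) : ℝ≥0∞ :=
  sInf {t | s < t ∧ t ≠ ⊤ ∧ a + ∫ u in s.toReal..t.toReal, v u = c}

/-- The successive hitting times `T*_k` of the boundary, `T*_0 = 0`, when `ξ k` is the position at
time `T*_k` (that is, just after the `k`-th jump for `k ≥ 1`). -/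
noncomputable def jumpTime (c : ℝ) (v : ℝ → ℝ) (ξ : ℕ → ℝ) : ℕ → ℝ≥0∞
  | 0 => 0
  | k + 1 => hitTime c v (ξ k) (jumpTime c v ξ k)

/-- The number `p*(t)` of jumps until time `t`. -/
noncomputable def jumpCount (c : ℝ) (v : ℝ → ℝ) (ξ : ℕ → ℝ) (t : ℝ) : ℕ∞ :=
  {i : ℕ | 1 ≤ i ∧ jumpTime c v ξ i ≤ ENNReal.ofReal t}.encard

/-- The trajectory: `X(t) = ξ_k + ∫_{T*_k}^t v(s) ds` for `t ∈ [T*_k, T*_{k+1})`, that is, with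
`k = p*(t)`. It is meaningful as long as `p*(t)` is finite. -/
noncomputable def trajectory (c : ℝ) (v : ℝ → ℝ) (ξ : ℕ → ℝ) (t : ℝ) : ℝ :=
  ξ (jumpCount c v ξ t).toNat +
    ∫ u in (jumpTime c v ξ (jumpCount c v ξ t).toNat).toReal..t, v u

section Random

variable {Ω : Type*} [MeasurableSpace Ω] {S : Set ℝ} {c : ℝ}

/-- The hitting times of the boundary for the random velocity `Y` and random positions `ξ`. -/
noncomputable def hittingTimes (Y : ℝ → Ω → S) (ξ : ℕ → Ω → Iio c) (k : ℕ) (ω : Ω) : ℝ≥0∞ :=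
  jumpTime c (fun t => (Y t ω : ℝ)) (fun i => (ξ i ω : ℝ)) k

/-- The piecewise linear process `X` with velocity `Y`, started at `ξ 0`, that jumps to `ξ k` at
its `k`-th hitting time of the boundary. -/
noncomputable def process (Y : ℝ → Ω → S) (ξ : ℕ → Ω → Iio c) (t : ℝ) (ω : Ω) : ℝ :=
  trajectory c (fun t => (Y t ω : ℝ)) (fun i => (ξ i ω : ℝ)) t

/-- The information carried by the whole velocity process and by the positions
`ξ 0, …, ξ k`. -/
abbrev history (Y : ℝ → Ω → S) (ξ : ℕ → Ω → Iio c) (k : ℕ) : MeasurableSpace Ω :=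
  (⨆ u ∈ Ici (0 : ℝ), MeasurableSpace.comap (Y u) inferInstance) ⊔
    ⨆ i ∈ Iic k, MeasurableSpace.comap (ξ i) inferInstance

/-- The law of the post-jump positions: given the velocities and the previous positions, the
position `ξ (k+1)` taken at the finite hitting time `T = T*_{k+1}` has law `ν_{Y(T-)}`. -/
structure HasJumpLaw (μ : Measure Ω) (Y : ℝ → Ω → S) (ν : S → Measure (Iio c))
    (ξ : ℕ → Ω → Iio c) : Prop where
  measurable : ∀ k, Measurable (ξ k)
  law : ∀ k, ∀ A : Set Ω, MeasurableSet[history Y ξ k] A →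
    ∀ B : Set (Iio c), MeasurableSet B →
    μ (A ∩ {ω | hittingTimes Y ξ (k + 1) ω < ⊤} ∩ ξ (k + 1) ⁻¹' B) =
      ∫⁻ ω in A ∩ {ω | hittingTimes Y ξ (k + 1) ω < ⊤},
        ν (Function.leftLim (fun t => Y t ω) (hittingTimes Y ξ (k + 1) ω).toReal) B ∂μ

end Random

end PLMP

/-! Velocities lie between `0` and `sSup S`, so covering the distance `c - ξ₀` takes at least `(c -
ξ₀) / sSup S > T`. Hence there is no jump on `[0,T]`, where `X ε t = ξ₀ + ε ∫_0^{t/ε} Y`. What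
remains is a weak law of large numbers for the chain, for an arbitrary initial law.

Invariance gives `p x * P t x y ≤ p y`, hence `P t x y ≤ p y / p x`: a majorant summable in `y` and
uniform in `t`. Because of it, limit points of the mean occupation times lose no mass; they are
invariant probabilities, hence equal to `p` by irreducibility (`IsInvariant.tendsto_occupation`).
The same majorant compares the chain started at `x` with the stationary one: for bounded centered
`g`, the correlation of `g (Y s)` with its integral over `[s,t]` is `o(t)`, so the second moment of
`∫_0^t g(Y)` on `{Y 0 = x}` is `o(t^2)`. Chebyshev's inequality and a sum over `x` give
`IsMarkovChain.tendsto_measureReal_integral_ge`.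

All paths are Lipschitz with the same constant, so pointwise convergence in probability is uniform.
It implies convergence in law in the space of continuous functions, which maps continuously into the
Skorokhod space. -/

namespace PLMP

/-! ### Regularity in time of the transition function -/

namespace IsTransitionFunction

variable {S : Set ℝ} {P : ℝ → S → S → ℝ} {Q : S → S → ℝ}

theorem le_one (hP : IsTransitionFunction P Q) {t : ℝ} (ht : 0 ≤ t) (x y : S) : P t x y ≤ 1 :=
  le_hasSum (hP.hasSum_one t ht x) y fun z _ => hP.nonneg t ht x z

theorem tendsto_same (hP : IsTransitionFunction P Q) (x : S) :
    Tendsto (fun t => P t x x) (𝓝[≥] 0) (𝓝 1) := by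
  have h := (hP.hasDeriv_zero x x).continuousWithinAt
  rw [ContinuousWithinAt, hP.zero_same] at h
  exact h

/-- Split according to the state at time `s`. Keeping only the term of state `x` in the
Chapman–Kolmogorov sums for `P (s + t) x z` and for `1 - P (s + t) x z` gives the two one-sided
bounds. -/
theorem abs_add_sub_le (hP : IsTransitionFunction P Q) {s t : ℝ} (hs : 0 ≤ s) (ht : 0 ≤ t)
    (x z : S) : |P (s + t) x z - P t x z| ≤ 1 - P s x x := by
  have hck := hP.chapman_kolmogorov s t hs ht x z
  have h1 := hP.le_one hs x x
  have ht0 := hP.nonneg t ht x z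
  have ht1 := hP.le_one ht x z
  have hlow : P s x x * P t x z ≤ P (s + t) x z :=
    le_hasSum hck x fun y _ => mul_nonneg (hP.nonneg s hs x y) (hP.nonneg t ht y z)
  have hup : 1 - P (s + t) x z ≥ P s x x * (1 - P t x z) := by
    have h := (hP.hasSum_one s hs x).sub hck
    have hy : ∀ y, P s x y - P s x y * P t y z = P s x y * (1 - P t y z) := fun y => by ring
    simp only [hy] at h
    exact le_hasSum h x fun y _ =>
      mul_nonneg (hP.nonneg s hs x y) (sub_nonneg.2 (hP.le_one ht y z))
  rw [abs_le]
  constructor <;> nlinarith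

/-- The bound `abs_add_sub_le` depends only on the time increment, and `P s x x → 1` as `s → 0`, so
continuity is even uniform. -/
theorem continuousOn (hP : IsTransitionFunction P Q) (x z : S) :
    ContinuousOn (fun t => P t x z) (Ici 0) := by
  have key : ∀ ε > 0, ∃ δ > 0, ∀ s t, 0 ≤ s → s ≤ t → t - s < δ → |P t x z - P s x z| < ε := by
    intro ε hε
    have h := (hP.tendsto_same x).eventually (lt_mem_nhds (show 1 - ε < 1 by linarith))
    obtain ⟨δ, hδ, h⟩ := (mem_nhdsGE_iff_exists_Ico_subset.mp h)
    refine ⟨δ, hδ, fun s t hs hst hd => ?_⟩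
    have h1 := hP.abs_add_sub_le (sub_nonneg.2 hst) hs x z
    rw [sub_add_cancel] at h1
    have h2 : 1 - ε < P (t - s) x x := h ⟨sub_nonneg.2 hst, hd⟩
    linarith
  rw [Metric.continuousOn_iff]
  intro t ht ε hε
  obtain ⟨δ, hδ, h⟩ := key ε hε
  refine ⟨δ, hδ, fun s hs hd => ?_⟩
  rw [Real.dist_eq] at hd ⊢
  rcases le_total s t with hst | hst
  · rw [abs_sub_comm]
    exact h s t hs hst (by rw [abs_sub_comm] at hd; exact (le_abs_self _).trans_lt hd)
  · exact h t s ht hst ((le_abs_self _).trans_lt hd)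

theorem intervalIntegrable (hP : IsTransitionFunction P Q) (x z : S) {a b : ℝ} (ha : 0 ≤ a)
    (hb : 0 ≤ b) : IntervalIntegrable (fun t => P t x z) volume a b :=
  ((hP.continuousOn x z).mono fun _ hu => (le_min ha hb).trans hu.1).intervalIntegrable

/-- Summation against a bounded function commutes with integration in time. -/
theorem hasSum_integral_mul [Countable S] (hP : IsTransitionFunction P Q) (x : S) {a b M : ℝ}
    (ha : 0 ≤ a) (hb : 0 ≤ b) (g : S → ℝ) (hg : ∀ y, |g y| ≤ M) :
    HasSum (fun y => (∫ s in a..b, P s x y) * g y) (∫ s in a..b, ∑' y, P s x y * g y) := by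
  have hpos : ∀ t ∈ uIoc a b, 0 ≤ t := fun t ht => (le_min ha hb).trans ht.1.le
  simp_rw [← intervalIntegral.integral_mul_const]
  refine intervalIntegral.hasSum_integral_of_dominated_convergence (fun y t => P t x y * M) ?_ ?_
    ?_ ?_ ?_
  · intro y
    exact (intervalIntegrable_iff.1
      ((hP.intervalIntegrable x y ha hb).mul_const (g y))).aestronglyMeasurable
  · refine fun y => .of_forall fun t ht => ?_
    rw [norm_mul, Real.norm_of_nonneg (hP.nonneg t (hpos t ht) x y)]
    exact mul_le_mul_of_nonneg_left (hg y) (hP.nonneg t (hpos t ht) x y)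
  · exact .of_forall fun t ht => ((hP.hasSum_one t (hpos t ht) x).mul_right M).summable
  · refine (intervalIntegrable_const (c := M)).congr fun t ht => ?_
    rw [((hP.hasSum_one t (hpos t ht) x).mul_right M).tsum_eq, one_mul]
  · refine .of_forall fun t ht => Summable.hasSum ?_
    refine Summable.of_norm_bounded ((hP.hasSum_one t (hpos t ht) x).mul_right M).summable fun y => ?_
    rw [norm_mul, Real.norm_of_nonneg (hP.nonneg t (hpos t ht) x y)]
    exact mul_le_mul_of_nonneg_left (hg y) (hP.nonneg t (hpos t ht) x y)

end IsTransitionFunction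

/-! ### Positivity, domination and uniqueness for the invariant probability -/

section Invariant

variable {S : Set ℝ} {P : ℝ → S → S → ℝ} {Q : S → S → ℝ}

theorem hasSum_measureReal_inter_preimage {Ω E : Type*} [MeasurableSpace Ω] {μ : Measure Ω}
    [IsFiniteMeasure μ] [Countable E] [MeasurableSpace E] [MeasurableSingletonClass E]
    {A : Set Ω} (hA : MeasurableSet A) {f : Ω → E}
    (hf : Measurable f) : HasSum (fun y => μ.real (A ∩ f ⁻¹' {y})) (μ.real A) := by
  have h := hasSum_integral_iUnion (μ := μ) (f := fun _ => (1 : ℝ)) (s := fun y => A ∩ f ⁻¹' {y})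
    (fun y => hA.inter (hf (measurableSet_singleton y)))
    (fun y z hyz => Disjoint.inter_left' _ (Disjoint.inter_right' _
      (Disjoint.preimage f (by simpa using hyz))))
    (integrable_const _).integrableOn
  have hU : ⋃ y, A ∩ f ⁻¹' {y} = A := by
    rw [← inter_iUnion, ← preimage_iUnion, iUnion_of_singleton, preimage_univ, inter_univ]
  simpa [hU] using h

theorem hasSum_measureReal_singleton [Countable S] (p : Measure S) [IsProbabilityMeasure p] :
    HasSum (fun y => p.real {y}) 1 := by
  simpa using hasSum_measureReal_inter_preimage (μ := p) .univ measurable_id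

theorem IsInvariant.pos [Countable S] (hP : IsTransitionFunction P Q) (hirr : IsIrreducible P)
    {p : Measure S} [IsProbabilityMeasure p] (hp : IsInvariant P p) (y : S) : 0 < p.real {y} := by
  have h1 := hasSum_measureReal_singleton p
  obtain ⟨x, hx⟩ : ∃ x, p.real {x} ≠ 0 := by
    by_contra! h
    simp only [h] at h1
    exact one_ne_zero (h1.unique hasSum_zero)
  have hx : 0 < p.real {x} := lt_of_le_of_ne measureReal_nonneg hx.symm
  obtain ⟨t, ht, hxy⟩ := hirr x y
  refine (mul_pos hx hxy).trans_le ?_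
  exact le_hasSum (hp t ht y) x fun z _ => mul_nonneg measureReal_nonneg (hP.nonneg t ht z y)

theorem IsInvariant.mul_le (hP : IsTransitionFunction P Q) {p : Measure S} (hp : IsInvariant P p)
    {t : ℝ} (ht : 0 ≤ t) (x y : S) : p.real {x} * P t x y ≤ p.real {y} :=
  le_hasSum (hp t ht y) x fun z _ => mul_nonneg measureReal_nonneg (hP.nonneg t ht z y)

/-- The majorant behind every dominated convergence over states below: it is summable in `y` and
does not depend on `t`. -/
theorem IsInvariant.le_div [Countable S] (hP : IsTransitionFunction P Q) (hirr : IsIrreducible P)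
    {p : Measure S} [IsProbabilityMeasure p] (hp : IsInvariant P p) {t : ℝ} (ht : 0 ≤ t)
    (x y : S) : P t x y ≤ p.real {y} / p.real {x} := by
  rw [le_div_iff₀ (hp.pos hP hirr x), mul_comm]
  exact hp.mul_le hP ht x y

/-- A summable signed invariant measure of an irreducible chain does not change sign. -/
theorem not_pos_and_neg_of_invariant (hP : IsTransitionFunction P Q) (hirr : IsIrreducible P)
    {d : S → ℝ} (hd : Summable d) (hinv : ∀ t, 0 ≤ t → ∀ z, HasSum (fun y => d y * P t y z) (d z))
    {x y : S} (hx : 0 < d x) (hy : d y < 0) : False := by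
  obtain ⟨t, ht, hpos⟩ := hirr y x
  have hdn : Summable fun y => |d y| := hd.abs
  have hrow : ∀ y, HasSum (fun z => |d y| * P t y z) |d y| := fun y => by
    simpa using (hP.hasSum_one t ht y).mul_left |d y|
  have hF : Summable (fun r : S × S => |d r.1| * P t r.1 r.2) := by
    rw [summable_prod_of_nonneg fun r => mul_nonneg (abs_nonneg _) (hP.nonneg t ht _ _)]
    refine ⟨fun y => (hrow y).summable, ?_⟩
    simpa only [(hrow _).tsum_eq] using hdn
  have hcol : ∀ z, Summable fun y => |d y| * P t y z := fun z =>
    hF.comp_injective (i := fun y => (y, z)) fun a b h => (Prod.ext_iff.1 h).1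
  -- The triangle inequality makes `|d|` subinvariant, strictly at `x`, since the negative term of
  -- `y` reaches `x` with positive probability. Summed over `z`, this contradicts the conservation
  -- of total mass `hswap`.
  have hle : ∀ z, |d z| ≤ ∑' y, |d y| * P t y z := fun z => by
    rw [← (hinv t ht z).tsum_eq]
    rw [← Real.norm_eq_abs]
    refine (norm_tsum_le_tsum_norm ?_).trans_eq ?_
    · refine (hcol z).congr fun y => ?_
      rw [norm_mul, Real.norm_of_nonneg (hP.nonneg t ht y z), Real.norm_eq_abs]
    · refine tsum_congr fun y => ?_
      rw [norm_mul, Real.norm_of_nonneg (hP.nonneg t ht y z), Real.norm_eq_abs]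
  have hlt : |d x| < ∑' y, |d y| * P t y x := by
    rw [abs_of_pos hx, ← (hinv t ht x).tsum_eq]
    refine Summable.tsum_lt_tsum (i := y) (fun z => ?_) ?_ (hinv t ht x).summable (hcol x)
    · exact mul_le_mul_of_nonneg_right (le_abs_self _) (hP.nonneg t ht z x)
    · exact mul_lt_mul_of_pos_right (hy.trans (abs_pos.2 hy.ne)) hpos
  have hswap : ∑' z, ∑' y, |d y| * P t y z = ∑' y, |d y| := by
    rw [Summable.tsum_comm (f := fun y z => |d y| * P t y z) hF]
    exact tsum_congr fun y => (hrow y).tsum_eq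
  have hsum : Summable fun z => ∑' y, |d y| * P t y z := hF.prod_symm.prod
  exact (Summable.tsum_lt_tsum hle hlt hdn hsum).ne hswap.symm

/-- An irreducible chain has at most one invariant probability. -/
theorem IsInvariant.eq_of_hasSum [Countable S] (hP : IsTransitionFunction P Q)
    (hirr : IsIrreducible P) {p : Measure S} [IsProbabilityMeasure p] (hp : IsInvariant P p)
    {α : S → ℝ} (hα : HasSum α 1) (hinv : ∀ t, 0 ≤ t → ∀ z, HasSum (fun y => α y * P t y z) (α z))
    (y : S) : α y = p.real {y} := by
  set d : S → ℝ := fun y => α y - p.real {y} with hd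
  have hd0 : HasSum d 0 := by simpa using hα.sub (hasSum_measureReal_singleton p)
  have hdinv : ∀ t, 0 ≤ t → ∀ z, HasSum (fun y => d y * P t y z) (d z) := fun t ht z => by
    simpa only [hd, sub_mul] using (hinv t ht z).sub (hp t ht z)
  have hsign := @not_pos_and_neg_of_invariant S P Q hP hirr d hd0.summable hdinv
  suffices d y = 0 by simpa [hd, sub_eq_zero] using this
  -- `d` has constant sign and total sum zero, so it vanishes.
  by_cases h : ∃ x, 0 < d x
  · obtain ⟨x, hx⟩ := h
    have hn : ∀ z, 0 ≤ d z := fun z => not_lt.1 fun hz => hsign hx hz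
    exact congrFun ((hasSum_zero_iff_of_nonneg hn).1 hd0) y
  · push Not at h
    have := (hasSum_zero_iff_of_nonneg (f := fun z => - d z) fun z => neg_nonneg.2 (h z)).1
      (by simpa using hd0.neg)
    simpa using congrFun this y

end Invariant

/-! ### Mean ergodic theorem for occupation times -/

section Ergodic

variable {S : Set ℝ} {P : ℝ → S → S → ℝ} {Q : S → S → ℝ}

namespace IsTransitionFunction

theorem integral_nonneg (hP : IsTransitionFunction P Q) (x y : S) {a b : ℝ} (ha : 0 ≤ a)
    (hab : a ≤ b) : 0 ≤ ∫ s in a..b, P s x y :=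
  intervalIntegral.integral_nonneg hab fun s hs => hP.nonneg s (ha.trans hs.1) x y

theorem integral_le (hP : IsTransitionFunction P Q) (x y : S) {a b C : ℝ} (ha : 0 ≤ a)
    (hab : a ≤ b) (hC : ∀ s, 0 ≤ s → P s x y ≤ C) : ∫ s in a..b, P s x y ≤ C * (b - a) := by
  have h := intervalIntegral.integral_mono_on hab
    (hP.intervalIntegrable x y ha (ha.trans hab)) (intervalIntegrable_const (c := C))
    fun s hs => hC s (ha.trans hs.1)
  rwa [intervalIntegral.integral_const, smul_eq_mul, mul_comm] at h

/-- Moving an occupation time by `t` changes it by at most `t`. -/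
theorem abs_integral_shift_sub_le (hP : IsTransitionFunction P Q) (x z : S) {r t : ℝ} (hr : 0 ≤ r)
    (ht : 0 ≤ t) : |(∫ s in (0 : ℝ)..r, P (s + t) x z) - ∫ s in (0 : ℝ)..r, P s x z| ≤ t := by
  rw [intervalIntegral.integral_comp_add_right (fun s => P s x z), zero_add]
  have e : (∫ s in t..r + t, P s x z) - ∫ s in (0 : ℝ)..r, P s x z =
      (∫ s in r..r + t, P s x z) - ∫ s in (0 : ℝ)..t, P s x z := by
    have h1 := intervalIntegral.integral_add_adjacent_intervals
      (hP.intervalIntegrable x z le_rfl ht) (hP.intervalIntegrable x z ht (add_nonneg hr ht))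
    have h2 := intervalIntegral.integral_add_adjacent_intervals
      (hP.intervalIntegrable x z le_rfl hr) (hP.intervalIntegrable x z hr (add_nonneg hr ht))
    linarith
  rw [e]
  have a1 := hP.integral_nonneg x z hr (le_add_of_nonneg_right ht)
  have a2 := hP.integral_nonneg x z le_rfl ht
  have a3 := hP.integral_le x z hr (le_add_of_nonneg_right (a := r) ht)
    fun s hs => hP.le_one hs x z
  have a4 := hP.integral_le x z le_rfl ht fun s hs => hP.le_one hs x z
  rw [abs_le]
  constructor <;> linarith

end IsTransitionFunction

/-- The mean occupation times of an irreducible positive recurrent chain converge to the invariant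
probability. -/
theorem IsInvariant.tendsto_occupation [Countable S] (hP : IsTransitionFunction P Q)
    (hirr : IsIrreducible P) {p : Measure S} [IsProbabilityMeasure p] (hp : IsInvariant P p)
    (x y : S) :
    Tendsto (fun r => (∫ s in (0 : ℝ)..r, P s x y) / r) atTop (𝓝 (p.real {y})) := by
  set A : ℝ → S → ℝ := fun r y => (∫ s in (0 : ℝ)..r, P s x y) / r with hA
  have hA0 : ∀ r, 0 < r → ∀ y, 0 ≤ A r y := fun r hr y =>
    div_nonneg (hP.integral_nonneg x y le_rfl hr.le) hr.le
  have hAC : ∀ C y, (∀ s, 0 ≤ s → P s x y ≤ C) → ∀ r, 0 < r → A r y ≤ C := fun C y hC r hr => by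
    have := hP.integral_le x y le_rfl hr.le hC
    rw [sub_zero] at this
    exact (div_le_iff₀ hr).2 this
  have hbd : Summable fun y => p.real {y} / p.real {x} :=
    (hasSum_measureReal_singleton p).summable.div_const _
  have hAsum : ∀ r, 0 < r → HasSum (A r) 1 := fun r hr => by
    have h := hP.hasSum_integral_mul x le_rfl hr.le (fun _ => 1) (M := 1) (by simp)
    have e : ∫ s in (0 : ℝ)..r, ∑' y, P s x y * 1 = r := by
      rw [intervalIntegral.integral_congr (g := fun _ => (1 : ℝ))]
      · simp
      · intro s hs
        rw [uIcc_of_le hr.le] at hs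
        simp only [mul_one]
        exact (hP.hasSum_one s hs.1 x).tsum_eq
    rw [e] at h
    simpa [hA, div_self hr.ne'] using h.div_const r
  have hAP : ∀ r, 0 < r → ∀ t, 0 ≤ t → ∀ z,
      HasSum (fun y => A r y * P t y z) ((∫ s in (0 : ℝ)..r, P (s + t) x z) / r) := by
    intro r hr t ht z
    have h := hP.hasSum_integral_mul x le_rfl hr.le (fun y => P t y z) (M := 1)
      (fun y => by rw [abs_of_nonneg (hP.nonneg t ht y z)]; exact hP.le_one ht y z)
    have e : ∫ s in (0 : ℝ)..r, ∑' y, P s x y * P t y z = ∫ s in (0 : ℝ)..r, P (s + t) x z := by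
      refine intervalIntegral.integral_congr fun s hs => ?_
      rw [uIcc_of_le hr.le] at hs
      exact (hP.chapman_kolmogorov s t hs.1 ht x z).tsum_eq
    rw [e] at h
    simpa only [hA, div_mul_eq_mul_div] using h.div_const r
  have hpos : ∀ᶠ r : ℝ in atTop, 0 < r := eventually_gt_atTop 0
  -- Along an ultrafilter all the bounded quantities `A r z` converge at once, without a diagonal
  -- extraction. It suffices to identify the limit `α` as an invariant probability.
  rw [tendsto_iff_ultrafilter]
  intro 𝓤 h𝓤
  have hlim : ∀ z, ∃ a, Tendsto (fun r => A r z) 𝓤 (𝓝 a) := fun z => by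
    obtain ⟨a, -, ha⟩ := isCompact_Icc.ultrafilter_le_nhds' (𝓤.map fun r => A r z)
      (s := Icc (0 : ℝ) 1) (h𝓤 (hpos.mono fun r hr =>
        ⟨hA0 r hr z, hAC 1 z (fun s hs => hP.le_one hs x z) r hr⟩))
    exact ⟨a, ha⟩
  choose α hα using hlim
  have hα0 : ∀ z, 0 ≤ α z := fun z =>
    ge_of_tendsto (hα z) (h𝓤 (hpos.mono fun r hr => hA0 r hr z))
  have hαb : ∀ z, α z ≤ p.real {z} / p.real {x} := fun z =>
    le_of_tendsto (hα z) (h𝓤 (hpos.mono fun r hr =>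
      hAC _ z (fun s hs => hp.le_div hP hirr hs x z) r hr))
  have hbound : ∀ᶠ r in (𝓤 : Filter ℝ), ∀ g : S → ℝ, (∀ y, |g y| ≤ 1) → ∀ y,
      ‖A r y * g y‖ ≤ p.real {y} / p.real {x} := h𝓤 (hpos.mono fun r hr g hg y => by
    rw [norm_mul, Real.norm_of_nonneg (hA0 r hr y)]
    exact (mul_le_of_le_one_right (hA0 r hr y) (hg y)).trans
      (hAC _ y (fun s hs => hp.le_div hP hirr hs x y) r hr))
  have hαs : Summable α := Summable.of_nonneg_of_le hα0 hαb hbd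
  have hPabs : ∀ t, 0 ≤ t → ∀ z y, |P t y z| ≤ 1 := fun t ht z y => by
    rw [abs_of_nonneg (hP.nonneg t ht y z)]
    exact hP.le_one ht y z
  have hα1 : HasSum α 1 := by
    have h := tendsto_tsum_of_dominated_convergence (𝓕 := (𝓤 : Filter ℝ)) (f := A) hbd hα
      (hbound.mono fun r hr y => by simpa using hr (fun _ => 1) (by simp) y)
    have h1 : Tendsto (fun r => ∑' y, A r y) 𝓤 (𝓝 1) :=
      (tendsto_congr' (h𝓤 (hpos.mono fun r hr => (hAsum r hr).tsum_eq))).2 tendsto_const_nhds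
    rw [← tendsto_nhds_unique h h1]
    exact hαs.hasSum
  have hαinv : ∀ t, 0 ≤ t → ∀ z, HasSum (fun y => α y * P t y z) (α z) := by
    intro t ht z
    have hs : Summable fun y => α y * P t y z := Summable.of_norm_bounded hαs fun y => by
      rw [norm_mul, Real.norm_of_nonneg (hα0 y)]
      exact mul_le_of_le_one_right (hα0 y) (hPabs t ht z y)
    have h := tendsto_tsum_of_dominated_convergence (𝓕 := (𝓤 : Filter ℝ))
      (f := fun r y => A r y * P t y z) hbd (fun y => (hα y).mul_const _)
      (hbound.mono fun r hr y => hr (fun y => P t y z) (hPabs t ht z) y)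
    have h1 : Tendsto (fun r => ∑' y, A r y * P t y z) 𝓤 (𝓝 (α z)) := by
      -- Applying `P t` shifts the time window by `t`, which changes the mean over `[0,r]` by at
      -- most `t / r`.
      have hdiff : Tendsto (fun r => ∑' y, A r y * P t y z - A r z) 𝓤 (𝓝 0) := by
        have h0 : Tendsto (fun r : ℝ => t / r) 𝓤 (𝓝 0) :=
          (tendsto_const_nhds.div_atTop tendsto_id).mono_left h𝓤
        refine squeeze_zero_norm' (h𝓤 (hpos.mono fun r hr => ?_)) h0
        rw [(hAP r hr t ht z).tsum_eq, ← sub_div, Real.norm_eq_abs, abs_div, abs_of_pos hr]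
        exact div_le_div_of_nonneg_right (hP.abs_integral_shift_sub_le x z hr.le ht) hr.le
      simpa using hdiff.add (hα z)
    rw [← tendsto_nhds_unique h h1]
    exact hs.hasSum
  rw [← hp.eq_of_hasSum hP hirr hα1 hαinv y]
  exact hα y

/-- The expected integral until time `r` of the centered function `g` along the chain, averaged in
absolute value over the starting point, is `o(r)`. -/
theorem IsInvariant.exists_sum_abs_integral_le [Countable S] (hP : IsTransitionFunction P Q)
    (hirr : IsIrreducible P) {p : Measure S} [IsProbabilityMeasure p] (hp : IsInvariant P p)
    {g : S → ℝ} {M : ℝ} (hg : ∀ y, |g y| ≤ M) (hg0 : HasSum (fun y => p.real {y} * g y) 0)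
    {δ : ℝ} (hδ : 0 < δ) :
    ∃ R, 0 ≤ R ∧ ∀ r, 0 ≤ r →
      Summable (fun y => p.real {y} * |∫ v in (0 : ℝ)..r, ∑' z, P v y z * g z|) ∧
      ∑' y, p.real {y} * |∫ v in (0 : ℝ)..r, ∑' z, P v y z * g z| ≤ δ * r + R := by
  set a : ℝ → S → ℝ := fun r y => ∫ v in (0 : ℝ)..r, ∑' z, P v y z * g z with ha
  have hps := hasSum_measureReal_singleton p
  obtain ⟨x₀⟩ : Nonempty S := by
    by_contra h
    rw [not_nonempty_iff] at h
    exact one_ne_zero (hps.unique hasSum_empty)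
  have hM : 0 ≤ M := (abs_nonneg _).trans (hg x₀)
  have hPg : ∀ v, 0 ≤ v → ∀ y, |∑' z, P v y z * g z| ≤ M := fun v hv y => by
    have h1 : ∀ z, ‖P v y z * g z‖ ≤ P v y z * M := fun z => by
      rw [norm_mul, Real.norm_of_nonneg (hP.nonneg v hv y z)]
      exact mul_le_mul_of_nonneg_left (hg z) (hP.nonneg v hv y z)
    have := tsum_of_norm_bounded ((hP.hasSum_one v hv y).mul_right M) h1
    rwa [one_mul] at this
  have haM : ∀ r, 0 ≤ r → ∀ y, |a r y| ≤ M * r := fun r hr y => by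
    have := intervalIntegral.norm_integral_le_of_norm_le_const (a := 0) (b := r) (C := M)
      (f := fun v => ∑' z, P v y z * g z) fun v hv => hPg v (by
        rw [uIoc_of_le hr] at hv; exact hv.1.le) y
    rwa [sub_zero, abs_of_nonneg hr] at this
  -- By Fubini, `a r y / r` is the integral of `g` against the mean occupation measure started at
  -- `y`, which converges to the `p`-integral of `g`, namely `0`.
  have hlim : ∀ y, Tendsto (fun r => a r y / r) atTop (𝓝 0) := fun y => by
    have h := tendsto_tsum_of_dominated_convergence (𝓕 := (atTop : Filter ℝ))
      (f := fun r z => (∫ s in (0 : ℝ)..r, P s y z) / r * g z)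
      ((hps.summable.div_const (p.real {y})).mul_right M)
      (fun z => (hp.tendsto_occupation hP hirr y z).mul_const (g z))
      ((eventually_gt_atTop 0).mono fun r hr z => by
        have h0 := hP.integral_nonneg y z le_rfl hr.le
        have h1 := hP.integral_le y z le_rfl hr.le fun s hs => hp.le_div hP hirr hs y z
        rw [sub_zero] at h1
        rw [norm_mul, Real.norm_of_nonneg (div_nonneg h0 hr.le)]
        exact mul_le_mul ((div_le_iff₀ hr).2 h1) (hg z) (abs_nonneg _)
          (div_nonneg measureReal_nonneg measureReal_nonneg))
    rw [hg0.tsum_eq] at h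
    refine h.congr' ((eventually_gt_atTop 0).mono fun r hr => ?_)
    have := (hP.hasSum_integral_mul y le_rfl hr.le g hg).div_const r
    simp only [← div_mul_eq_mul_div] at this
    exact this.tsum_eq
  have hsum : ∀ r, 0 ≤ r → Summable fun y => p.real {y} * |a r y| := fun r hr =>
    Summable.of_nonneg_of_le (fun y => mul_nonneg measureReal_nonneg (abs_nonneg _))
      (fun y => mul_le_mul_of_nonneg_left (haM r hr y) measureReal_nonneg)
      (hps.summable.mul_right (M * r))
  have hβ : Tendsto (fun r => ∑' y, p.real {y} * (|a r y| / r)) atTop (𝓝 0) := by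
    have h := tendsto_tsum_of_dominated_convergence (𝓕 := (atTop : Filter ℝ))
      (f := fun r y => p.real {y} * (|a r y| / r)) (g := fun _ => (0 : ℝ))
      (hps.summable.mul_right M) (fun y => ?_)
      ((eventually_gt_atTop 0).mono fun r hr y => ?_)
    · simpa using h
    · have h1 : Tendsto (fun r => |a r y / r|) atTop (𝓝 0) := by simpa using (hlim y).abs
      have h2 : Tendsto (fun r => |a r y| / r) atTop (𝓝 0) :=
        h1.congr' ((eventually_gt_atTop 0).mono fun r hr => by rw [abs_div, abs_of_pos hr])
      simpa using h2.const_mul (p.real {y})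
    · rw [Real.norm_of_nonneg (mul_nonneg measureReal_nonneg (div_nonneg (abs_nonneg _) hr.le))]
      exact mul_le_mul_of_nonneg_left ((div_le_iff₀ hr).2 (haM r hr.le y)) measureReal_nonneg
  obtain ⟨R, hR⟩ := eventually_atTop.1 ((hβ.eventually_lt_const hδ).and (eventually_gt_atTop 0))
  have hR0 : 0 < R := (hR R le_rfl).2
  -- For `r ≥ R` the mean is below `δ`; for `r ≤ R` the trivial bound `M * r ≤ M * R` is absorbed in
  -- the constant.
  refine ⟨M * R, mul_nonneg hM hR0.le, fun r hr => ⟨hsum r hr, ?_⟩⟩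
  rcases le_total R r with h | h
  · have h1 := (hR r h).1
    have hr' : 0 < r := hR0.trans_le h
    simp only [← mul_div_assoc, tsum_div_const] at h1
    rw [div_lt_iff₀ hr'] at h1
    exact h1.le.trans (le_add_of_nonneg_right (mul_nonneg hM hR0.le))
  · have h1 : ∑' y, p.real {y} * |a r y| ≤ ∑' y, p.real {y} * (M * r) :=
      (hsum r hr).tsum_le_tsum
        (fun y => mul_le_mul_of_nonneg_left (haM r hr y) measureReal_nonneg)
        (hps.summable.mul_right (M * r))
    rw [(hps.mul_right (M * r)).tsum_eq, one_mul] at h1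
    have h2 := mul_le_mul_of_nonneg_left h hM
    have h3 := mul_nonneg hδ.le hr
    linarith

end Ergodic

/-! ### Right-continuous processes and second moments of their time integrals -/

section RightContinuous

variable {Ω : Type*} [MeasurableSpace Ω]

/-- A right-continuous measurable process is jointly measurable. -/
theorem measurable_uncurry_of_rightContinuous {u : ℝ → Ω → ℝ} (hm : ∀ t, Measurable (u t))
    (hr : ∀ ω t, ContinuousWithinAt (fun s => u s ω) (Ioi t) t) :
    Measurable (Function.uncurry u) := by
  -- With `k = ⌊(n + 1) * t⌋`, the grid point `τ n k` lies in `(t, t + 1/(n + 1)]`. The `+ 1` puts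
  -- it strictly to the right of `t`, where right-continuity applies.
  let τ : ℕ → ℤ → ℝ := fun n k => (k + 1) / (n + 1)
  let U : ℕ → ℝ × Ω → ℝ := fun n r => u (τ n ⌊(n + 1) * r.1⌋) r.2
  refine measurable_of_tendsto_metrizable (f := U) (fun n => ?_) ?_
  · have h1 : Measurable fun q : ℤ × Ω => u (τ n q.1) q.2 :=
      measurable_from_prod_countable_right fun k => hm (τ n k)
    exact h1.comp ((Int.measurable_floor.comp (measurable_fst.const_mul _)).prodMk measurable_snd)
  · rw [tendsto_pi_nhds]
    rintro ⟨t, ω⟩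
    refine (hr ω t).tendsto.comp (tendsto_nhdsWithin_iff.2 ⟨?_, .of_forall fun n => ?_⟩)
    · have h1 : Tendsto (fun n : ℕ => t + 1 / ((n : ℝ) + 1)) atTop (𝓝 t) := by
        simpa using tendsto_one_div_add_atTop_nhds_zero_nat.const_add t
      refine tendsto_of_tendsto_of_tendsto_of_le_of_le tendsto_const_nhds h1 (fun n => ?_)
        fun n => ?_
      · have hn : (0 : ℝ) < n + 1 := by positivity
        simp only [τ]
        rw [le_div_iff₀ hn, mul_comm]
        exact (Int.lt_floor_add_one _).le
      · have hn : (0 : ℝ) < n + 1 := by positivity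
        simp only [τ]
        rw [div_le_iff₀ hn, add_mul t, one_div, inv_mul_cancel₀ hn.ne', mul_comm t]
        exact add_le_add_left (Int.floor_le _) 1
    · have hn : (0 : ℝ) < n + 1 := by positivity
      simp only [τ, mem_Ioi]
      rw [lt_div_iff₀ hn, mul_comm]
      exact Int.lt_floor_add_one _

variable {f : ℝ → Ω → ℝ} {M : ℝ}

theorem intervalIntegrable_of_measurable_uncurry (hf : Measurable (Function.uncurry f))
    (hM : ∀ s ω, |f s ω| ≤ M) (ω : Ω) (a b : ℝ) :
    IntervalIntegrable (fun s => f s ω) volume a b :=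
  (intervalIntegrable_const (c := M)).mono_fun'
    (hf.comp measurable_prodMk_right).aestronglyMeasurable (.of_forall fun s => hM s ω)

theorem measurable_intervalIntegral (hf : Measurable (Function.uncurry f)) (a b : ℝ) :
    Measurable fun ω => ∫ s in a..b, f s ω := by
  have h : StronglyMeasurable fun r : Ω × ℝ => f r.2 r.1 :=
    (hf.comp measurable_swap).stronglyMeasurable
  simp only [intervalIntegral]
  exact (h.integral_prod_right' (ν := volume.restrict (Ioc a b))).measurable.sub
    (h.integral_prod_right' (ν := volume.restrict (Ioc b a))).measurable

/-- The second moment of a time integral is controlled by the correlations of the process with its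
future integral. -/
theorem integral_sq_intervalIntegral_le {μ : Measure Ω} [IsFiniteMeasure μ]
    (hf : Measurable (Function.uncurry f))
    (hr : ∀ ω t, ContinuousWithinAt (fun s => f s ω) (Ioi t) t) (hM : ∀ s ω, |f s ω| ≤ M)
    {t K : ℝ} (ht : 0 ≤ t)
    (hK : ∀ s, 0 ≤ s → s ≤ t → |∫ ω, f s ω * (∫ u in s..t, f u ω) ∂μ| ≤ K) :
    ∫ ω, (∫ s in (0 : ℝ)..t, f s ω) ^ 2 ∂μ ≤ 2 * t * K := by
  have hint := intervalIntegrable_of_measurable_uncurry hf hM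
  set W : ℝ → Ω → ℝ := fun s ω => ∫ u in s..t, f u ω with hW
  have hWcont : ∀ ω, Continuous fun s => W s ω := fun ω => by
    simp only [hW]
    simp_rw [intervalIntegral.integral_symm t]
    exact (intervalIntegral.continuous_primitive (hint ω) t).neg
  have hWm : Measurable (Function.uncurry W) :=
    measurable_uncurry_of_continuous_of_measurable hWcont
      fun s => measurable_intervalIntegral hf s t
  have hWb : ∀ s ω, 0 ≤ s → s ≤ t → |W s ω| ≤ M * t := fun s ω hs hst => by
    have h := intervalIntegral.norm_integral_le_of_norm_le_const (a := s) (b := t) (C := M)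
      (f := fun u => f u ω) fun u _ => hM u ω
    rw [abs_of_nonneg (sub_nonneg.2 hst)] at h
    exact h.trans (mul_le_mul_of_nonneg_left (sub_le_self t hs) ((abs_nonneg _).trans (hM s ω)))
  -- `W t = 0`, and `W ^ 2` has right derivative `-2 f W`. As `f` is only right-continuous, the
  -- fundamental theorem for right derivatives is used.
  have hsq : ∀ ω, (∫ s in (0 : ℝ)..t, f s ω) ^ 2 = ∫ s in (0 : ℝ)..t, 2 * (f s ω * W s ω) := by
    intro ω
    have hder : ∀ s ∈ Ioo (min 0 t) (max 0 t),
        HasDerivWithinAt (fun s => W s ω ^ 2) (-(2 * (f s ω * W s ω))) (Ioi s) s := by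
      intro s _
      have hmeas : StronglyMeasurable fun s => f s ω :=
        (hf.comp measurable_prodMk_right).stronglyMeasurable
      have h := intervalIntegral.integral_hasDerivWithinAt_left (s := Ici s) (t := Ioi s)
        (hint ω s t) (hmeas.stronglyMeasurableAtFilter) (hr ω s)
      have h2 := (h.mono Ioi_subset_Ici_self).pow 2
      refine h2.congr_deriv ?_
      simp only [hW]
      ring
    have hprod : IntervalIntegrable (fun s => -(2 * (f s ω * W s ω))) volume 0 t :=
      (((hint ω 0 t).mul_continuousOn (hWcont ω).continuousOn).const_mul 2).neg
    have h := intervalIntegral.integral_eq_sub_of_hasDeriv_right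
      ((hWcont ω).pow 2).continuousOn hder hprod
    rw [intervalIntegral.integral_neg] at h
    have hWt : W t ω = 0 := intervalIntegral.integral_same
    simp only [Pi.pow_apply, hWt] at h
    change W 0 ω ^ 2 = _
    linarith
  have hprod : Integrable (Function.uncurry fun s ω => 2 * (f s ω * W s ω))
      ((volume.restrict (Ioc 0 t)).prod μ) := by
    have hm : Measurable (Function.uncurry fun s ω => 2 * (f s ω * W s ω)) :=
      (hf.mul hWm).const_mul 2
    refine Integrable.of_bound hm.aestronglyMeasurable (2 * (M * (M * t))) ?_
    have hset : ∀ᵐ r ∂((volume.restrict (Ioc 0 t)).prod μ), r.1 ∈ Ioc 0 t :=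
      Measure.quasiMeasurePreserving_fst.ae (ae_restrict_mem measurableSet_Ioc)
    filter_upwards [hset] with r hrs
    simp only [Function.uncurry, norm_mul, Real.norm_eq_abs, abs_two]
    exact mul_le_mul_of_nonneg_left (mul_le_mul (hM _ _) (hWb _ _ hrs.1.le hrs.2) (abs_nonneg _)
      ((abs_nonneg _).trans (hM r.1 r.2))) zero_le_two
  simp_rw [hsq]
  rw [← intervalIntegral_integral_swap (by rwa [uIoc_of_le ht])]
  have h := intervalIntegral.norm_integral_le_of_norm_le_const (a := 0) (b := t) (C := 2 * K)
    (f := fun s => ∫ ω, 2 * (f s ω * W s ω) ∂μ) fun s hs => by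
      rw [uIoc_of_le ht] at hs
      rw [integral_const_mul, norm_mul, Real.norm_two]
      exact mul_le_mul_of_nonneg_left (hK s hs.1.le hs.2) zero_le_two
  rw [sub_zero, abs_of_nonneg ht] at h
  calc _ ≤ _ := le_abs_self _
    _ ≤ _ := h
    _ = _ := by ring

end RightContinuous

/-! ### Weak law of large numbers for the chain -/

namespace IsMarkovChain

variable {Ω : Type*} [MeasurableSpace Ω] {μ : Measure Ω} {S : Set ℝ} {P : ℝ → S → S → ℝ} {Q : S → S → ℝ} {Y : ℝ → Ω → S} {g : S → ℝ} {M : ℝ}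

/-- The chain is controlled only at nonnegative times. Reading it at `max s 0` freezes it at `Y 0`
before time `0`, giving a process right-continuous on the whole line. -/
theorem eventually_eq (hY : IsMarkovChain μ P Y) (ω : Ω) (t : ℝ) :
    ∀ᶠ s in 𝓝[>] t, Y (max s 0) ω = Y (max t 0) ω := by
  rcases lt_or_ge t 0 with ht | ht
  · filter_upwards [nhdsWithin_le_nhds (Iio_mem_nhds ht)] with s hs
    rw [max_eq_right (le_of_lt hs), max_eq_right ht.le]
  · filter_upwards [hY.right_cont ω t ht, self_mem_nhdsWithin] with s hs hst
    rw [max_eq_left (ht.trans (le_of_lt hst)), max_eq_left ht, hs]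

theorem continuousWithinAt (hY : IsMarkovChain μ P Y) (g : S → ℝ) (ω : Ω) (t : ℝ) :
    ContinuousWithinAt (fun s => g (Y (max s 0) ω)) (Ioi t) t :=
  tendsto_const_nhds.congr' ((hY.eventually_eq ω t).mono fun _ hs => (congrArg g hs).symm)

theorem measurable_uncurry [Countable S] (hY : IsMarkovChain μ P Y) (g : S → ℝ) :
    Measurable (Function.uncurry fun s ω => g (Y (max s 0) ω)) :=
  measurable_uncurry_of_rightContinuous
    (fun t => (Measurable.of_discrete (f := g)).comp (hY.measurable _ (le_max_right t 0)))
    (hY.continuousWithinAt g)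

theorem measureReal_le [IsProbabilityMeasure μ] (hY : IsMarkovChain μ P Y)
    (hP : IsTransitionFunction P Q) {s : ℝ} (hs : 0 ≤ s)
    (x y : S) : μ.real ({ω | Y 0 ω = x} ∩ {ω | Y s ω = y}) ≤ P s x y := by
  have h := hY.markov 0 s le_rfl hs univ MeasurableSet.univ x y
  rw [univ_inter, zero_add] at h
  rw [h]
  exact mul_le_of_le_one_left (hP.nonneg s hs x y) measureReal_le_one

/-- The Markov property with past event `{Y 0 = x}` gives the joint law of `(Y s, Y (s + t))` atom
by atom. -/
theorem integral_mul [Countable S] [IsProbabilityMeasure μ]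
    (hY : IsMarkovChain μ P Y) (hg : ∀ y, |g y| ≤ M) (x : S) {s t : ℝ}
    (hs : 0 ≤ s) (ht : 0 ≤ t) :
    ∫ ω in {ω | Y 0 ω = x}, g (Y s ω) * g (Y (s + t) ω) ∂μ =
      ∑' y, μ.real ({ω | Y 0 ω = x} ∩ {ω | Y s ω = y}) * (g y * ∑' z, P t y z * g z) := by
  set B : Set Ω := {ω | Y 0 ω = x}
  have hmeas : Measurable fun ω => (Y s ω, Y (s + t) ω) :=
    (hY.measurable s hs).prodMk (hY.measurable (s + t) (add_nonneg hs ht))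
  have hB : MeasurableSet[⨆ u ∈ Icc (0 : ℝ) s, MeasurableSpace.comap (Y u) inferInstance] B := by
    refine le_iSup₂ (f := fun u (_ : u ∈ Icc (0 : ℝ) s) =>
      MeasurableSpace.comap (Y u) inferInstance) 0 ⟨le_rfl, hs⟩ _ ?_
    exact ⟨{x}, measurableSet_singleton x, rfl⟩
  have hBm : MeasurableSet B := hY.measurable 0 le_rfl (measurableSet_singleton x)
  have hcell : ∀ y z, ((μ.restrict B).map fun ω => (Y s ω, Y (s + t) ω)).real {(y, z)} =
      μ.real (B ∩ {ω | Y s ω = y}) * P t y z := fun y z => by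
    rw [← hY.markov s t hs ht B hB y z, map_measureReal_apply hmeas (measurableSet_singleton _),
      measureReal_restrict_apply (hmeas (measurableSet_singleton _))]
    congr 1
    ext ω
    simp only [mem_inter_iff, mem_preimage, mem_singleton_iff, Prod.mk.injEq, mem_ofPred_eq]
    tauto
  have hM : ∀ r : S × S, ‖g r.1 * g r.2‖ ≤ M * M := fun r => by
    rw [norm_mul]
    exact mul_le_mul (hg _) (hg _) (abs_nonneg _) ((abs_nonneg _).trans (hg r.1))
  have hint : Integrable (fun r : S × S => g r.1 * g r.2)
      ((μ.restrict B).map fun ω => (Y s ω, Y (s + t) ω)) :=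
    Integrable.of_bound (Measurable.of_discrete).aestronglyMeasurable (M * M) (.of_forall hM)
  have h1 := integral_map (μ := μ.restrict B) hmeas.aemeasurable
    (f := fun r : S × S => g r.1 * g r.2) (Measurable.of_discrete).aestronglyMeasurable
  rw [← h1, integral_countable hint, Summable.tsum_prod]
  · refine tsum_congr fun y => ?_
    simp only [hcell, smul_eq_mul]
    rw [← tsum_mul_left, ← tsum_mul_left]
    exact tsum_congr fun z => by ring
  · have := hasSum_measureReal_inter_preimage (μ := (μ.restrict B).map fun ω =>
      (Y s ω, Y (s + t) ω)) .univ measurable_id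
    simp only [univ_inter, preimage_id] at this
    refine Summable.of_norm_bounded (this.summable.mul_right (M * M)) fun r => ?_
    rw [norm_smul, Real.norm_of_nonneg measureReal_nonneg]
    exact mul_le_mul_of_nonneg_left (hM r) measureReal_nonneg

/-- Conditioning at time `s` replaces the future integral by its expectation from `Y s`. The law of
`Y s` on `{Y 0 = x}` is at most `p / p x`, which leaves a stationary average, independent of the
initial law. -/
theorem abs_integral_mul_integral_le [Countable S] [IsProbabilityMeasure μ]
    (hY : IsMarkovChain μ P Y) (hP : IsTransitionFunction P Q) (hirr : IsIrreducible P)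
    {p : Measure S} [IsProbabilityMeasure p] (hp : IsInvariant P p)
    (hg : ∀ y, |g y| ≤ M) (x : S) {s t : ℝ} (hs : 0 ≤ s) (hst : s ≤ t)
    (hsum : Summable (fun y => p.real {y} * |∫ v in (0 : ℝ)..(t - s), ∑' z, P v y z * g z|)) :
    |∫ ω in {ω | Y 0 ω = x}, g (Y (max s 0) ω) * (∫ u in s..t, g (Y (max u 0) ω)) ∂μ| ≤
      M / p.real {x} *
        ∑' y, p.real {y} * |∫ v in (0 : ℝ)..(t - s), ∑' z, P v y z * g z| := by
  have hM : 0 ≤ M := (abs_nonneg _).trans (hg x)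
  have hpx := hp.pos hP hirr x
  set B : Set Ω := {ω | Y 0 ω = x}
  set c : S → ℝ := fun y => μ.real (B ∩ {ω | Y s ω = y}) with hc
  have hBm : MeasurableSet B := hY.measurable 0 le_rfl (measurableSet_singleton x)
  have hcs : Summable c := (hasSum_measureReal_inter_preimage hBm (hY.measurable s hs)).summable
  have hcp : ∀ y, c y ≤ p.real {y} / p.real {x} := fun y =>
    (hY.measureReal_le hP hs x y).trans (hp.le_div hP hirr hs x y)
  have hf := hY.measurable_uncurry g
  have hps := hasSum_measureReal_singleton p
  have hts : 0 ≤ t - s := sub_nonneg.2 hst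
  have hPg : ∀ v, 0 ≤ v → ∀ y, |∑' z, P v y z * g z| ≤ M := fun v hv y => by
    have h1 : ∀ z, ‖P v y z * g z‖ ≤ P v y z * M := fun z => by
      rw [norm_mul, Real.norm_of_nonneg (hP.nonneg v hv y z)]
      exact mul_le_mul_of_nonneg_left (hg z) (hP.nonneg v hv y z)
    have := tsum_of_norm_bounded ((hP.hasSum_one v hv y).mul_right M) h1
    rwa [one_mul] at this
  -- The uniform majorant makes this a Weierstrass M-test; continuity supplies the measurability
  -- needed to exchange sum and integral.
  have hcont : ∀ y, ContinuousOn (fun v => ∑' z, P v y z * g z) (Ici 0) := fun y => by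
    refine continuousOn_tsum (u := fun z => p.real {z} / p.real {y} * M)
      (fun z => (hP.continuousOn y z).mul_const _) ((hps.summable.div_const _).mul_right M) ?_
    intro z v hv
    rw [norm_mul, Real.norm_of_nonneg (hP.nonneg v hv y z)]
    exact mul_le_mul (hp.le_div hP hirr hv y z) (hg z) (abs_nonneg _)
      (div_nonneg measureReal_nonneg measureReal_nonneg)
  have hswap : ∫ ω in B, g (Y (max s 0) ω) * (∫ u in s..t, g (Y (max u 0) ω)) ∂μ =
      ∫ u in s..t, ∫ ω in B, g (Y (max s 0) ω) * g (Y (max u 0) ω) ∂μ := by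
    rw [intervalIntegral_integral_swap]
    · simp_rw [intervalIntegral.integral_const_mul]
    · rw [uIoc_of_le hst]
      have hm : Measurable (Function.uncurry fun u ω => g (Y (max s 0) ω) * g (Y (max u 0) ω)) :=
        ((hf.comp measurable_prodMk_left).comp measurable_snd).mul hf
      refine Integrable.of_bound hm.aestronglyMeasurable (M * M) (.of_forall fun r => ?_)
      simp only [Function.uncurry, norm_mul]
      exact mul_le_mul (hg _) (hg _) (abs_nonneg _) hM
  have hcorr : ∫ u in s..t, ∫ ω in B, g (Y (max s 0) ω) * g (Y (max u 0) ω) ∂μ =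
      ∫ v in (0 : ℝ)..(t - s), ∑' y, c y * (g y * ∑' z, P v y z * g z) := by
    have e := intervalIntegral.integral_comp_add_left (a := 0) (b := t - s)
      (fun u => ∫ ω in B, g (Y (max s 0) ω) * g (Y (max u 0) ω) ∂μ) s
    rw [add_zero, add_sub_cancel] at e
    rw [← e]
    refine intervalIntegral.integral_congr fun v hv => ?_
    rw [uIcc_of_le hts] at hv
    rw [← hY.integral_mul hg x hs hv.1, max_eq_left hs, max_eq_left (add_nonneg hs hv.1)]
  have hsumint : HasSum (fun y => ∫ v in (0 : ℝ)..(t - s), c y * (g y * ∑' z, P v y z * g z))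
      (∫ v in (0 : ℝ)..(t - s), ∑' y, c y * (g y * ∑' z, P v y z * g z)) := by
    have hbd : ∀ y, ∀ v ∈ uIoc 0 (t - s),
        ‖c y * (g y * ∑' z, P v y z * g z)‖ ≤ c y * (M * M) := fun y v hv => by
      rw [uIoc_of_le hts] at hv
      rw [norm_mul, norm_mul, Real.norm_of_nonneg measureReal_nonneg]
      exact mul_le_mul_of_nonneg_left
        (mul_le_mul (hg y) (hPg v hv.1.le y) (abs_nonneg _) hM) measureReal_nonneg
    refine intervalIntegral.hasSum_integral_of_dominated_convergence (fun y _ => c y * (M * M))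
      (fun y => ?_) (fun y => .of_forall (hbd y)) (.of_forall fun v _ => hcs.mul_right _)
      intervalIntegrable_const
      (.of_forall fun v hv => (Summable.of_norm_bounded (hcs.mul_right (M * M))
        fun y => hbd y v hv).hasSum)
    refine ContinuousOn.aestronglyMeasurable (ContinuousOn.mul continuousOn_const
      (continuousOn_const.mul ((hcont y).mono fun v hv => ?_))) measurableSet_uIoc
    rw [uIoc_of_le hts] at hv
    exact hv.1.le
  rw [hswap, hcorr, ← hsumint.tsum_eq, ← tsum_mul_left]
  rw [← Real.norm_eq_abs]
  refine tsum_of_norm_bounded (hsum.mul_left (M / p.real {x})).hasSum fun y => ?_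
  rw [intervalIntegral.integral_const_mul, intervalIntegral.integral_const_mul, norm_mul, norm_mul,
    Real.norm_of_nonneg measureReal_nonneg]
  calc c y * (‖g y‖ * ‖∫ v in (0 : ℝ)..(t - s), ∑' z, P v y z * g z‖)
      ≤ p.real {y} / p.real {x} * (M * ‖∫ v in (0 : ℝ)..(t - s), ∑' z, P v y z * g z‖) :=
        mul_le_mul (hcp y) (mul_le_mul_of_nonneg_right (hg y) (norm_nonneg _))
          (mul_nonneg (norm_nonneg _) (norm_nonneg _))
          (div_nonneg measureReal_nonneg measureReal_nonneg)
    _ = _ := by rw [Real.norm_eq_abs]; ring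

/-- **Weak law of large numbers** for a bounded centered function of an irreducible positive
recurrent continuous-time Markov chain, for an arbitrary initial law. -/
theorem tendsto_measureReal_integral_ge [Countable S] [IsProbabilityMeasure μ]
    (hY : IsMarkovChain μ P Y) (hP : IsTransitionFunction P Q) (hirr : IsIrreducible P)
    {p : Measure S} [IsProbabilityMeasure p] (hp : IsInvariant P p)
    (hg : ∀ y, |g y| ≤ M) (hg0 : HasSum (fun y => p.real {y} * g y) 0) {a : ℝ} (ha : 0 < a) :
    Tendsto (fun t => μ.real {ω | a * t ≤ |∫ s in (0 : ℝ)..t, g (Y (max s 0) ω)|}) atTop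
      (𝓝 0) := by
  have hf := hY.measurable_uncurry g
  set V : ℝ → Ω → ℝ := fun t ω => ∫ s in (0 : ℝ)..t, g (Y (max s 0) ω) with hV
  have hVm : ∀ t, Measurable (V t) := fun t => measurable_intervalIntegral hf 0 t
  have hA : ∀ t, MeasurableSet {ω | a * t ≤ |V t ω|} := fun t =>
    measurableSet_le measurable_const (hVm t).abs
  have hY0 := hY.measurable 0 le_rfl
  have hmain : ∀ x : S, Tendsto (fun t => μ.real ({ω | a * t ≤ |V t ω|} ∩ Y 0 ⁻¹' {x})) atTop
      (𝓝 0) := by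
    intro x
    have hM : 0 ≤ M := (abs_nonneg _).trans (hg x)
    have hpx := hp.pos hP hirr x
    rw [Metric.tendsto_atTop]
    intro e he
    -- The left-hand side is the part of the Chebyshev bound that does not decay in `t`; the
    -- remaining part is `O(1/t)`.
    obtain ⟨δ, hδ, hδe⟩ : ∃ δ > 0, 2 * (M / p.real {x}) * δ / a ^ 2 < e / 2 := by
      refine ⟨e * a ^ 2 / (8 * (M / p.real {x} + 1)), by positivity, ?_⟩
      have hm : 0 ≤ M / p.real {x} := by positivity
      set m := M / p.real {x}
      have : 2 * m * (e * a ^ 2 / (8 * (m + 1))) / a ^ 2 = e / 4 * (m / (m + 1)) := by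
        field_simp
        ring
      rw [this]
      have : m / (m + 1) ≤ 1 := (div_le_one (by positivity)).2 (by linarith)
      nlinarith
    obtain ⟨R, hR, hsum⟩ := hp.exists_sum_abs_integral_le hP hirr hg hg0 hδ
    have hbound : ∀ t, 0 < t → μ.real ({ω | a * t ≤ |V t ω|} ∩ Y 0 ⁻¹' {x}) ≤
        2 * (M / p.real {x}) * δ / a ^ 2 + 2 * (M / p.real {x}) * R / a ^ 2 / t := by
      intro t ht
      have h2 := integral_sq_intervalIntegral_le (μ := μ.restrict {ω | Y 0 ω = x}) hf
        (hY.continuousWithinAt g) (fun s ω => hg _) ht.le (K := M / p.real {x} * (δ * t + R))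
        fun s hs hst => by
          obtain ⟨h3, h4⟩ := hsum (t - s) (sub_nonneg.2 hst)
          refine (hY.abs_integral_mul_integral_le hP hirr hp hg x hs hst h3).trans ?_
          refine mul_le_mul_of_nonneg_left (h4.trans ?_) (by positivity)
          have := mul_le_mul_of_nonneg_left (sub_le_self t hs) hδ.le
          linarith
      have hVb : ∀ ω, ‖V t ω ^ 2‖ ≤ (M * t) ^ 2 := fun ω => by
        have h := intervalIntegral.norm_integral_le_of_norm_le_const (a := 0) (b := t) (C := M)
          (f := fun s => g (Y (max s 0) ω)) fun u _ => hg _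
        rw [sub_zero, abs_of_pos ht] at h
        rw [norm_pow]
        exact pow_le_pow_left₀ (norm_nonneg _) h 2
      have hint : Integrable (fun ω => V t ω ^ 2) (μ.restrict {ω | Y 0 ω = x}) :=
        Integrable.of_bound ((hVm t).pow_const 2).aestronglyMeasurable _ (.of_forall hVb)
      have h5 := mul_meas_ge_le_integral_of_nonneg (.of_forall fun ω => sq_nonneg _) hint
        ((a * t) ^ 2)
      have h6 : {ω | (a * t) ^ 2 ≤ V t ω ^ 2} = {ω | a * t ≤ |V t ω|} := by
        ext ω
        simp only [mem_ofPred_eq]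
        rw [sq_le_sq, abs_of_pos (mul_pos ha ht)]
      rw [h6, measureReal_restrict_apply (hA t)] at h5
      have h7 := h5.trans h2
      have h8 : (0 : ℝ) < (a * t) ^ 2 := by positivity
      rw [mul_comm, ← le_div_iff₀ h8] at h7
      refine h7.trans_eq ?_
      field_simp
    have hlim : Tendsto (fun t : ℝ => 2 * (M / p.real {x}) * R / a ^ 2 / t) atTop (𝓝 0) :=
      tendsto_const_nhds.div_atTop tendsto_id
    obtain ⟨t₀, ht₀⟩ := eventually_atTop.1
      ((hlim.eventually_lt_const (half_pos he)).and (eventually_gt_atTop 0))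
    refine ⟨t₀, fun t ht => ?_⟩
    rw [Real.dist_eq, sub_zero, abs_of_nonneg measureReal_nonneg]
    have := hbound t (ht₀ t ht).2
    have := (ht₀ t ht).1
    linarith
  -- The rate depends on the initial state `x`; the initial probabilities dominate and allow the sum
  -- over `x`.
  have h := tendsto_tsum_of_dominated_convergence (𝓕 := (atTop : Filter ℝ))
    (hasSum_measureReal_inter_preimage (μ := μ) .univ hY0).summable hmain
    (.of_forall fun t x => by
      rw [Real.norm_of_nonneg measureReal_nonneg]
      exact measureReal_mono (inter_subset_inter_left _ (subset_univ _)))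
  rw [tsum_zero] at h
  exact h.congr fun t => (hasSum_measureReal_inter_preimage (hA t) hY0).tsum_eq

end IsMarkovChain

/-! ### No jump before the first hitting time -/

section HittingTimes

variable {c : ℝ} {v : ℝ → ℝ} {ξ : ℕ → ℝ} {M : ℝ}

theorem ofReal_div_le_hitTime {a : ℝ} (hM : 0 < M) (hv : ∀ t, 0 ≤ t → |v t| ≤ M) :
    ENNReal.ofReal ((c - a) / M) ≤ hitTime c v a 0 := by
  refine le_sInf ?_
  rintro t ⟨-, ht, hc⟩
  rw [ENNReal.ofReal_le_iff_le_toReal ht, div_le_iff₀ hM]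
  have h := intervalIntegral.norm_integral_le_of_norm_le_const (a := 0) (b := t.toReal) (C := M)
    (f := v) fun u hu => hv u (by rw [uIoc_of_le ENNReal.toReal_nonneg] at hu; exact hu.1.le)
  rw [sub_zero, abs_of_nonneg ENNReal.toReal_nonneg, mul_comm] at h
  rw [ENNReal.toReal_zero] at hc
  have := (le_abs_self _).trans h
  linarith

theorem jumpTime_mono : Monotone (jumpTime c v ξ) :=
  monotone_nat_of_le_succ fun _ => le_sInf fun _ ht => ht.1.le

/-- Before the first hitting time of the boundary, the trajectory does not jump. -/
theorem trajectory_of_lt_jumpTime {t : ℝ} (ht : ENNReal.ofReal t < jumpTime c v ξ 1) :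
    trajectory c v ξ t = ξ 0 + ∫ u in (0 : ℝ)..t, v u := by
  have h : jumpCount c v ξ t = 0 := by
    rw [jumpCount, encard_eq_zero, eq_empty_iff_forall_notMem]
    rintro i ⟨hi, hit⟩
    exact absurd ((jumpTime_mono hi).trans hit) (not_le.2 ht)
  simp [trajectory, h, jumpTime]

end HittingTimes

/-! ### Continuous paths: measurability, uniform convergence, embedding in the Skorokhod space -/

section ContinuousPaths

variable {T : ℝ}

theorem isCadlag_of_continuous {x : Icc (0 : ℝ) T → ℝ} (hx : Continuous x) : IsCadlag x :=
  fun t => ⟨hx.continuousWithinAt, x t, hx.continuousAt.tendsto.mono_left nhdsWithin_le_nhds⟩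

/-- A continuous path as an element of the Skorokhod space. -/
def Skorokhod.ofContinuousMap (x : C(Icc (0 : ℝ) T, ℝ)) : Skorokhod T :=
  ⟨x, isCadlag_of_continuous x.continuous⟩

/-- The identity time change shows that the Skorokhod distance is at most the uniform one, so
convergence in law can be proved for the uniform norm and then transported. -/
theorem Skorokhod.lipschitzWith_ofContinuousMap :
    LipschitzWith 1 (Skorokhod.ofContinuousMap : C(Icc (0 : ℝ) T, ℝ) → Skorokhod T) := by
  intro x y
  rw [ENNReal.coe_one, one_mul]
  refine (iInf_le _ (OrderIso.refl _)).trans (max_le ?_ (iSup_le fun t => ?_))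
  · simp
  · simp only [ofContinuousMap, OrderIso.refl_apply, edist_dist]
    exact ENNReal.ofReal_le_ofReal (ContinuousMap.dist_apply_le_dist t)

/-- A random continuous function on a compact metric space is measurable if its values are. -/
theorem measurable_continuousMap_of_eval {Ω K : Type*} [MeasurableSpace Ω] [MetricSpace K]
    [CompactSpace K] [MeasurableSpace C(K, ℝ)] [BorelSpace C(K, ℝ)] {Z : Ω → C(K, ℝ)}
    (hZ : ∀ k, Measurable fun ω => Z ω k) : Measurable Z := by
  obtain ⟨D, hDc, hD⟩ := TopologicalSpace.exists_countable_dense K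
  have := hDc.to_subtype
  -- Evaluation on a countable dense set is a continuous injection between Polish spaces, hence a
  -- measurable embedding (Lusin–Souslin).
  let e : C(K, ℝ) → D → ℝ := fun x d => x d
  have he : Continuous e := continuous_pi fun d => continuous_eval_const (d : K)
  have hinj : Function.Injective e := fun x y hxy => ContinuousMap.ext fun k =>
    congrFun (x.continuous.ext_on hD y.continuous fun d hd => congrFun hxy ⟨d, hd⟩) k
  exact (he.measurableEmbedding hinj).measurable_comp_iff.1
    (measurable_pi_lambda _ fun d => hZ d)

/-- For random Lipschitz functions on a compact space, pointwise convergence in probability implies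
uniform convergence in probability. -/
theorem tendstoInMeasure_continuousMap {Ω K ι : Type*} [MeasurableSpace Ω] {μ : Measure Ω}
    [IsFiniteMeasure μ] [MetricSpace K] [CompactSpace K] {l : Filter ι} {Z : ι → Ω → C(K, ℝ)}
    {z : C(K, ℝ)} {M : ℝ} (hM : 0 ≤ M) (hZ : ∀ i ω k k', |Z i ω k - Z i ω k'| ≤ M * dist k k')
    (hz : ∀ k k', |z k - z k'| ≤ M * dist k k')
    (h : ∀ k, ∀ a > 0, Tendsto (fun i => μ.real {ω | a ≤ |Z i ω k - z k|}) l (𝓝 0)) :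
    TendstoInMeasure μ Z l fun _ => z := by
  rw [tendstoInMeasure_iff_measureReal_dist]
  intro a ha
  -- On balls of this radius each of the two Lipschitz errors is at most `a / 4`, leaving `a / 2` at
  -- the centers. `M + 1` avoids dividing by zero.
  have hr : 0 < a / (4 * (M + 1)) := by positivity
  obtain ⟨s, -, hsf, hs⟩ := finite_cover_balls_of_compact (isCompact_univ (X := K)) hr
  have hsub : ∀ i, {ω | a ≤ dist (Z i ω) z} ⊆
      ⋃ k ∈ hsf.toFinset, {ω | a / 2 ≤ |Z i ω k - z k|} := by
    intro i ω hω
    by_contra hn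
    simp only [mem_iUnion, Finite.mem_toFinset, mem_ofPred_eq, not_exists, not_le] at hn
    refine not_lt.2 hω ((ContinuousMap.dist_lt_iff ha).2 fun k => ?_)
    obtain ⟨k', hk', hkk⟩ := mem_iUnion₂.1 (hs (mem_univ k))
    have h1 := hn k' hk'
    have h2 := hZ i ω k k'
    have h3 := hz k k'
    have h4 : M * dist k k' ≤ a / 4 := by
      have : M * dist k k' ≤ (M + 1) * (a / (4 * (M + 1))) :=
        mul_le_mul (by linarith) (Metric.mem_ball.1 hkk).le dist_nonneg (by linarith)
      refine this.trans_eq ?_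
      field_simp
    rw [Real.dist_eq]
    rw [abs_lt] at h1 ⊢
    rw [abs_le] at h2 h3
    constructor <;> linarith
  have hlim : Tendsto (fun i => ∑ k ∈ hsf.toFinset, μ.real {ω | a / 2 ≤ |Z i ω k - z k|}) l
      (𝓝 0) := by
    simpa using tendsto_finsetSum hsf.toFinset fun k _ => h k (a / 2) (half_pos ha)
  exact squeeze_zero (fun _ => measureReal_nonneg)
    (fun i => (measureReal_mono (hsub i) (measure_ne_top _ _)).trans (measureReal_biUnion_finset_le _ _)) hlim

end ContinuousPaths

/-! ### Averaging of the accelerated chain -/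

section Averaging

variable {S : Set ℝ} {P : ℝ → S → S → ℝ} {Q : S → S → ℝ}

theorem integral_accelerate {Ω : Type*} {Y : ℝ → Ω → S} {ε : ℝ} (hε : 0 < ε) {t : ℝ} (ht : 0 ≤ t)
    (ω : Ω) : ∫ s in (0 : ℝ)..t, (accelerate Y ε s ω : ℝ) =
      ε * ∫ s in (0 : ℝ)..(t / ε), (Y (max s 0) ω : ℝ) := by
  have h := intervalIntegral.integral_comp_div (a := 0) (b := t)
    (fun s => (Y (max s 0) ω : ℝ)) hε.ne'
  rw [zero_div, smul_eq_mul] at h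
  rw [← h]
  refine intervalIntegral.integral_congr fun s hs => ?_
  rw [uIcc_of_le ht] at hs
  simp only [accelerate]
  rw [max_eq_left (div_nonneg hs.1 hε.le)]

/-- The integrated accelerated chain converges in probability to the mean drift. -/
theorem IsMarkovChain.tendsto_accelerate {Ω : Type*} [MeasurableSpace Ω] {μ : Measure Ω}
    {Y : ℝ → Ω → S} [Countable S] [IsProbabilityMeasure μ] (hY : IsMarkovChain μ P Y)
    (hP : IsTransitionFunction P Q) (hirr : IsIrreducible P) {p : Measure S} [IsProbabilityMeasure p] (hp : IsInvariant P p) {M m : ℝ}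
    (hM : ∀ y : S, |(y : ℝ)| ≤ M) (hm : HasSum (fun y : S => p.real {y} * y) m)
    {t : ℝ} (ht : 0 ≤ t) {a : ℝ} (ha : 0 < a) :
    Tendsto (fun ε : Ioi (0 : ℝ) =>
      μ.real {ω | a ≤ |(∫ s in (0 : ℝ)..t, (accelerate Y ε s ω : ℝ)) - m * t|})
      (comap (fun ε : Ioi (0 : ℝ) => (ε : ℝ)) (𝓝 0)) (𝓝 0) := by
  rcases ht.eq_or_lt with rfl | ht0
  · simpa [not_le.2 ha] using tendsto_const_nhds
  have hg : ∀ y : S, |(y : ℝ) - m| ≤ M + |m| := fun y =>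
    (abs_sub _ _).trans (add_le_add_left (hM y) _)
  have hg0 : HasSum (fun y : S => p.real {y} * ((y : ℝ) - m)) 0 := by
    simpa [mul_sub] using hm.sub ((hasSum_measureReal_singleton p).mul_right m)
  -- At time `t / ε` the level `a / t` gives the threshold `a / ε`, which becomes `a` after
  -- multiplication by `ε`.
  have hlln := hY.tendsto_measureReal_integral_ge hP hirr hp hg hg0 (div_pos ha ht0)
  have htime : Tendsto (fun ε : Ioi (0 : ℝ) => t / (ε : ℝ))
      (comap (fun ε : Ioi (0 : ℝ) => (ε : ℝ)) (𝓝 0)) atTop := by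
    have h1 : Tendsto (fun ε : Ioi (0 : ℝ) => (ε : ℝ))
        (comap (fun ε : Ioi (0 : ℝ) => (ε : ℝ)) (𝓝 0)) (𝓝[>] 0) :=
      tendsto_nhdsWithin_iff.2 ⟨tendsto_comap, .of_forall fun ε => ε.2⟩
    exact (tendsto_inv_nhdsGT_zero.comp h1).const_mul_atTop ht0
  refine (hlln.comp htime).congr fun ε => ?_
  have hε : 0 < (ε : ℝ) := ε.2
  simp only [Function.comp]
  congr 1
  ext ω
  have hint : IntervalIntegrable (fun s => (Y (max s 0) ω : ℝ)) volume 0 (t / ε) :=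
    intervalIntegrable_of_measurable_uncurry (hY.measurable_uncurry fun y => (y : ℝ))
      (fun s ω => hM _) ω _ _
  have e : (∫ s in (0 : ℝ)..t, (accelerate Y ε s ω : ℝ)) - m * t =
      ε * ∫ s in (0 : ℝ)..(t / ε), ((Y (max s 0) ω : ℝ) - m) := by
    rw [integral_accelerate hε ht, intervalIntegral.integral_sub hint intervalIntegrable_const,
      intervalIntegral.integral_const, smul_eq_mul]
    field_simp
    ring
  rw [mem_ofPred_eq, mem_ofPred_eq, e, abs_mul, abs_of_pos hε, div_mul_div_cancel₀ ht0.ne',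
    div_le_iff₀ hε, mul_comm]

end Averaging

end PLMP

/-- Averaging away from the boundary. Here `S` is the set of velocities, `T` is
`(c - ξ₀) / sup S - η`, and `X ε` is the piecewise linear process driven by `Y(·/ε)`, with
post-jump positions `ξ ε 1, ξ ε 2, …`. -/
theorem proposition2p1 {Ω : Type*} [MeasurableSpace Ω] (μ : Measure Ω) [IsProbabilityMeasure μ]
    (S : Set ℝ) (hS_count : S.Countable) (hS_pos : S ⊆ Ioi 0) (hS_bdd : BddAbove S)
    (P : ℝ → S → S → ℝ) (Q : S → S → ℝ) (hP : PLMP.IsTransitionFunction P Q)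
    (hirr : PLMP.IsIrreducible P)
    (p : Measure S) [IsProbabilityMeasure p] (hp : PLMP.IsInvariant P p)
    (Y : ℝ → Ω → S) (hY : PLMP.IsMarkovChain μ P Y)
    (c : ℝ) (ν : S → Measure (Iio c)) (hν : ∀ y, IsProbabilityMeasure (ν y))
    (ξ₀ : Iio c) (ξ : Ioi (0 : ℝ) → ℕ → Ω → Iio c) (hξ₀ : ∀ ε ω, ξ ε 0 ω = ξ₀)
    (hξ : ∀ ε : Ioi (0 : ℝ), PLMP.HasJumpLaw μ (PLMP.accelerate Y ε) ν (ξ ε))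
    (η : ℝ) (hη : 0 < η) (T : ℝ) (hT : T = (c - ξ₀) / sSup S - η)
    (X : Ioi (0 : ℝ) → ℝ → Ω → ℝ)
    (hX : ∀ ε : Ioi (0 : ℝ), X ε = PLMP.process (PLMP.accelerate Y ε) (ξ ε))
    (Xbar : ℝ → ℝ)
    (hXbar : Xbar = fun t => ξ₀ + ∫ _ in (0 : ℝ)..t, ∫ y : S, (y : ℝ) ∂p) :
    -- the boundary is not reached before time `T`
    (∀ (ε : Ioi (0 : ℝ)) (ω : Ω),
      ENNReal.ofReal T < PLMP.hittingTimes (PLMP.accelerate Y ε) (ξ ε) 1 ω) ∧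
    -- the limit is a deterministic linear path, with the averaged velocity
    (Integrable (fun y : S => (y : ℝ)) p ∧ Summable (fun y : S => (y : ℝ) * p.real {y}) ∧
      ∀ t, Xbar t = ξ₀ + (∑' y : S, (y : ℝ) * p.real {y}) * t) ∧
    -- the paths on `[0,T]` are càdlàg, and `X ε` converges in law to `Xbar` as `ε → 0`
    ∃ (hc : ∀ ε ω, PLMP.IsCadlag (fun t : Icc (0 : ℝ) T => X ε t ω))
      (hc' : PLMP.IsCadlag (fun t : Icc (0 : ℝ) T => Xbar t)),
      TendstoInDistribution
        (fun (ε : Ioi (0 : ℝ)) (ω : Ω) =>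
          (⟨fun t : Icc (0 : ℝ) T => X ε t ω, hc ε ω⟩ : PLMP.Skorokhod T))
        (comap (fun ε : Ioi (0 : ℝ) => (ε : ℝ)) (𝓝 0))
        (fun _ : Ω => (⟨fun t : Icc (0 : ℝ) T => Xbar t, hc'⟩ : PLMP.Skorokhod T))
        (fun _ => μ) μ := by
  have := hS_count.to_subtype
  obtain ⟨x₀⟩ : Nonempty S := p.nonempty_of_neZero
  set M := sSup S
  have hMy : ∀ y : S, |(y : ℝ)| ≤ M := fun y => by
    rw [abs_of_pos (hS_pos y.2)]
    exact le_csSup hS_bdd y.2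
  have hM : 0 < M := lt_of_lt_of_le (hS_pos x₀.2) (le_csSup hS_bdd x₀.2)
  have hint : Integrable (fun y : S => (y : ℝ)) p :=
    Integrable.of_bound Measurable.of_discrete.aestronglyMeasurable M (.of_forall hMy)
  have hsummable : Summable (fun y : S => p.real {y} * (y : ℝ)) :=
    Summable.of_norm_bounded ((PLMP.hasSum_measureReal_singleton p).summable.mul_right M) fun y => by
      rw [norm_mul, Real.norm_of_nonneg measureReal_nonneg]
      exact mul_le_mul_of_nonneg_left (hMy y) measureReal_nonneg
  have hm : HasSum (fun y : S => p.real {y} * (y : ℝ)) (∫ y : S, (y : ℝ) ∂p) := by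
    rw [integral_countable hint]
    exact hsummable.hasSum
  set m := ∫ y : S, (y : ℝ) ∂p
  have hmM : |m| ≤ M := by
    simpa using norm_integral_le_of_norm_le_const (μ := p) (f := fun y : S => (y : ℝ))
      (.of_forall hMy)
  have hXbar' : ∀ t, Xbar t = ξ₀ + m * t := fun t => by
    rw [hXbar]
    simp [mul_comm]
  have hhit : ∀ (ε : Ioi (0 : ℝ)) (ω : Ω),
      ENNReal.ofReal T < PLMP.hittingTimes (PLMP.accelerate Y ε) (ξ ε) 1 ω := fun ε ω => by
    -- Positivity of the bound keeps the inequality strict after `ENNReal.ofReal`, even when `T` is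
    -- negative.
    have hpos : 0 < (c - (ξ₀ : ℝ)) / M := div_pos (sub_pos.2 ξ₀.2) hM
    have h1 : ENNReal.ofReal T < ENNReal.ofReal ((c - (ξ₀ : ℝ)) / M) :=
      (ENNReal.ofReal_lt_ofReal_iff hpos).2 (by rw [hT]; linarith)
    refine h1.trans_le ?_
    simpa only [PLMP.hittingTimes, PLMP.jumpTime, hξ₀] using
      PLMP.ofReal_div_le_hitTime (c := c) (a := ξ₀) hM
        (v := fun t => (PLMP.accelerate Y ε t ω : ℝ)) fun t _ => hMy _
  have hXeq : ∀ (ε : Ioi (0 : ℝ)) (ω : Ω), ∀ t ∈ Icc 0 T,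
      X ε t ω = ξ₀ + ε * ∫ s in (0 : ℝ)..(t / ε), (Y (max s 0) ω : ℝ) := fun ε ω t ht => by
    rw [hX, PLMP.process, PLMP.trajectory_of_lt_jumpTime
      ((ENNReal.ofReal_le_ofReal ht.2).trans_lt (hhit ε ω)), hξ₀,
      PLMP.integral_accelerate ε.2 ht.1]
  have hf := hY.measurable_uncurry fun y => (y : ℝ)
  have hvint := PLMP.intervalIntegrable_of_measurable_uncurry hf fun s ω => hMy _
  have hcont : ∀ (ε : Ioi (0 : ℝ)) (ω : Ω), Continuous fun t : Icc (0 : ℝ) T => X ε t ω :=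
    fun ε ω => by
      have h1 : Continuous fun t : Icc (0 : ℝ) T =>
          (ξ₀ : ℝ) + ε * ∫ s in (0 : ℝ)..((t : ℝ) / ε), (Y (max s 0) ω : ℝ) :=
        continuous_const.add (continuous_const.mul
          ((intervalIntegral.continuous_primitive (hvint ω) 0).comp
            (continuous_subtype_val.div_const _)))
      exact h1.congr fun t => (hXeq ε ω t t.2).symm
  have hcont' : Continuous fun t : Icc (0 : ℝ) T => Xbar t := by
    simp only [hXbar']
    fun_prop
  refine ⟨hhit, ⟨hint, hsummable.congr fun y => mul_comm _ _, fun t => ?_⟩,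
    fun ε ω => PLMP.isCadlag_of_continuous (hcont ε ω), PLMP.isCadlag_of_continuous hcont', ?_⟩
  · rw [hXbar', ← hm.tsum_eq]
    simp only [mul_comm]
  borelize C(Icc (0 : ℝ) T, ℝ)
  let Z : Ioi (0 : ℝ) → Ω → C(Icc (0 : ℝ) T, ℝ) := fun ε ω => ⟨fun t => X ε t ω, hcont ε ω⟩
  have hZm : ∀ ε, Measurable (Z ε) := fun ε => by
    refine PLMP.measurable_continuousMap_of_eval fun t => ?_
    have h : (fun ω => Z ε ω t) = fun ω =>
        (ξ₀ : ℝ) + ε * ∫ s in (0 : ℝ)..((t : ℝ) / ε), (Y (max s 0) ω : ℝ) :=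
      funext fun ω => hXeq ε ω t t.2
    rw [h]
    exact ((PLMP.measurable_intervalIntegral hf _ _).const_mul _).const_add _
  have hlim : TendstoInMeasure μ Z (comap (fun ε : Ioi (0 : ℝ) => (ε : ℝ)) (𝓝 0))
      fun _ => ⟨fun t => Xbar t, hcont'⟩ := by
    refine PLMP.tendstoInMeasure_continuousMap hM.le (fun ε ω t t' => ?_) (fun t t' => ?_)
      fun t a ha => ?_
    · have hε : 0 < (ε : ℝ) := ε.2
      have h := intervalIntegral.norm_integral_le_of_norm_le_const (a := t' / ε) (b := t / ε)
        (C := M) (f := fun s => (Y (max s 0) ω : ℝ)) fun s _ => hMy _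
      have e : Z ε ω t - Z ε ω t' = ε * ∫ s in (t' / ε : ℝ)..(t / ε), (Y (max s 0) ω : ℝ) := by
        rw [← intervalIntegral.integral_interval_sub_left (hvint ω 0 _) (hvint ω 0 _)]
        simp only [Z, ContinuousMap.coe_mk, hXeq ε ω t t.2, hXeq ε ω t' t'.2]
        ring
      rw [e, abs_mul, abs_of_pos hε]
      refine (mul_le_mul_of_nonneg_left h hε.le).trans_eq ?_
      rw [← sub_div, abs_div, abs_of_pos hε, Subtype.dist_eq, Real.dist_eq]
      field_simp
    · simp only [ContinuousMap.coe_mk, hXbar']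
      rw [add_sub_add_left_eq_sub, ← mul_sub, abs_mul]
      exact mul_le_mul_of_nonneg_right hmM (abs_nonneg _)
    · refine (hY.tendsto_accelerate hP hirr hp hMy hm t.2.1 ha).congr fun ε => ?_
      congr 1
      ext ω
      simp only [Z, ContinuousMap.coe_mk, hXbar', hXeq ε ω t t.2, mem_ofPred_eq,
        PLMP.integral_accelerate ε.2 t.2.1 ω, add_sub_add_left_eq_sub]
  -- Convergence in probability gives convergence in law for the uniform norm; the continuous
  -- mapping theorem carries it to the J1 topology.
  exact (hlim.tendstoInDistribution_of_aemeasurable (fun ε => (hZm ε).aemeasurable)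
    aemeasurable_const).continuous_comp PLMP.Skorokhod.lipschitzWith_ofContinuousMap.continuous
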